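/- A graph $G$ consists of a nonempty set $V$ of vertices and a symmetric adjacency relation $\sim$ on $V$; loops are allowed. The independence complex $\mathrm{Ind}(G)$ is the simplicial complex whose simplices are the finite sets $\sigma\subseteq V$ such that $a\not\sim b$ for all $a,b\in\sigma$ (so a looped vertex lies in no simplex); it is regarded as a topological space through its geometric realization with the weak topology. Let $L_2$ be the graph with vertices $0,1,2$ and edges $\{0,1\}$, $\{1,2\}$ and a loop at $0$, and let $G\times L_2$ be the categorical product, with vertex set $V\times\{0,1,2\}$ and $(g,i)\sim(g',i')$ if and only if $g\sim g'$ in $G$ and $i\sim i'$ in $L_2$. The Mycielskian $M_2(G)$ is the graph obtained from $G\times L_2$ by identifying all the vertices with second coordinate $2$ to a single vertex (two classes being adjacent if and only if they have adjacent representatives). **Theorem.** For any graph $G$ (with at least one vertex), there is a homotopy equivalence $$\mathrm{Ind}(M_2(G))\simeq\Sigma(\mathrm{Ind}(G)),$$ where $\Sigma$ denotes the unreduced suspension, with the convention $\Sigma\emptyset=S^0$. -/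

import Mathlib

/-- An undirected graph on the vertex set `V`, in which loops are allowed: a symmetric
adjacency relation. A simple graph is one whose adjacency relation is irreflexive. -/
@[ext]
structure LoopGraph (V : Type*) where
  Adj : V → V → Prop
  symm : ∀ {a b : V}, Adj a b → Adj b a

namespace LoopGraph

/-- The categorical product `G × H`: `(g, h) ∼ (g', h')` iff `g ∼ g'` and `h ∼ h'`. -/
def prod {V W : Type*} (G : LoopGraph V) (H : LoopGraph W) : LoopGraph (V × W) where
  Adj p q := G.Adj p.1 q.1 ∧ H.Adj p.2 q.2
  symm h := ⟨G.symm h.1, H.symm h.2⟩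

/-- The quotient graph `G / ∼`: two classes are adjacent iff they have adjacent
representatives. -/
def quotient {V : Type*} (G : LoopGraph V) (S : Setoid V) : LoopGraph (Quotient S) where
  Adj a b := ∃ p q : V, Quotient.mk S p = a ∧ Quotient.mk S q = b ∧ G.Adj p q
  symm := fun ⟨p, q, hp, hq, h⟩ => ⟨q, p, hq, hp, G.symm h⟩

/-- The path `L_r` with vertices `0, …, r` and edges `{i, i + 1}`, with a loop at `0`. -/
def loopedPath (r : ℕ) : LoopGraph (Fin (r + 1)) where
  Adj i j := i.val + 1 = j.val ∨ j.val + 1 = i.val ∨ (i = 0 ∧ j = 0)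
  symm h := by
    rcases h with h | h | h
    · exact Or.inr (Or.inl h)
    · exact Or.inl h
    · exact Or.inr (Or.inr ⟨h.2, h.1⟩)

/-- The equivalence relation on `V × {0, …, r}` which identifies all the pairs whose second
coordinate is `r`, and nothing else. -/
def topSetoid (V : Type*) (r : ℕ) : Setoid (V × Fin (r + 1)) where
  r p q := p = q ∨ (p.2 = Fin.last r ∧ q.2 = Fin.last r)
  iseqv :=
    { refl := fun _ => Or.inl rfl
      symm := by
        rintro p q (h | h)
        · exact Or.inl h.symm
        · exact Or.inr ⟨h.2, h.1⟩
      trans := by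
        rintro p q s (rfl | h) (rfl | h')
        · exact Or.inl rfl
        · exact Or.inr h'
        · exact Or.inr h
        · exact Or.inr ⟨h.1, h'.2⟩ }

/-- The `r`-th generalised Mycielskian `M_r(G) = (G × L_r) / ∼_r` (for `r ≥ 1`).
The Mycielskian of `G` is `G.mycielskian 2`. -/
def mycielskian {V : Type*} (G : LoopGraph V) (r : ℕ) :
    LoopGraph (Quotient (topSetoid V r)) :=
  (G.prod (loopedPath r)).quotient (topSetoid V r)

/-- The independence complex: its simplices are the finite sets of vertices on which `G` induces
no edge (in particular, a looped vertex lies in no simplex). Mathlib's complexes do not list the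
empty simplex, which contributes no point to the geometric realization. -/
def indepComplex {V : Type*} (G : LoopGraph V) : PreAbstractSimplicialComplex V where
  faces := {s | s.Nonempty ∧ ∀ a ∈ s, ∀ b ∈ s, ¬ G.Adj a b}
  isRelLowerSet_faces := fun _ hs =>
    ⟨hs.1, fun _ hts ht => ⟨ht, fun a ha b hb => hs.2 a (hts ha) b (hts hb)⟩⟩

end LoopGraph

namespace PreAbstractSimplicialComplex

/-- The geometric realization `|K|`, in barycentric coordinates: the families of nonnegative
reals, indexed by the vertices, with sum `1` and whose support is a simplex of `K`. -/
def Realization {V : Type*} (K : PreAbstractSimplicialComplex V) : Type _ :=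
  {x : V →₀ ℝ // x.support ∈ K.faces ∧ (∀ v, 0 ≤ x v) ∧ (x.sum fun _ a => a) = 1}

/-- The closed simplex of `|K|` spanned by `s`. -/
def ClosedSimplex {V : Type*} (K : PreAbstractSimplicialComplex V) (s : Finset V) : Type _ :=
  {x : K.Realization // x.1.support ⊆ s}

/-- The Euclidean topology of a closed simplex, as a subset of `ℝ^s`. -/
instance {V : Type*} (K : PreAbstractSimplicialComplex V) (s : Finset V) :
    TopologicalSpace (K.ClosedSimplex s) :=
  TopologicalSpace.induced (fun x (v : s) => x.1.1 (v : V)) (inferInstance : TopologicalSpace (s → ℝ))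

/-- The weak topology of `|K|`: a set is open iff its intersection with each closed simplex
of `K` is open in that simplex. -/
instance {V : Type*} (K : PreAbstractSimplicialComplex V) : TopologicalSpace K.Realization :=
  ⨆ s : K.faces, TopologicalSpace.coinduced
    (fun x : K.ClosedSimplex (s : Finset V) => x.1) inferInstance

end PreAbstractSimplicialComplex

/-- The gluing of the cylinder `X × [0, 1]` to two poles. -/
inductive SuspensionRel (X : Type*) : (X × unitInterval) ⊕ Bool → (X × unitInterval) ⊕ Bool → Prop
  | bottom (x : X) : SuspensionRel X (Sum.inl (x, 0)) (Sum.inr false)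
  | top (x : X) : SuspensionRel X (Sum.inl (x, 1)) (Sum.inr true)

/-- The (unreduced) suspension `ΣX`: the homotopy pushout of `pt ← X → pt`, that is, `X × [0, 1]`
with `X × {0}` glued to one point and `X × {1}` to another. The suspension of the empty space is
the two-point space `S⁰`. -/
def Suspension (X : Type*) : Type _ := Quot (SuspensionRel X)

instance (X : Type*) [TopologicalSpace X] : TopologicalSpace (Suspension X) :=
  inferInstanceAs (TopologicalSpace (Quot (SuspensionRel X)))

/-! If some vertex `v` of the graph has no neighbour, then `Ind(G)` is a cone over `v`. The vertex
`lower v` is isolated in the Mycielskian, so both sides are contractible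
(`nonempty_homotopyEquiv_of_isolated`).

Otherwise the apex is adjacent to every upper vertex and to no lower one. The complex is then the
union of two subcomplexes: the cone from the apex over the copy of `Ind(G)` on the lower vertices,
and the independent sets avoiding the apex. In the second, adding `upper v` to a set containing
`lower v` keeps it independent. That subcomplex can therefore be pushed into the full simplex on the
upper vertices, which is contractible. Two contractible pieces meet along `Ind(G)`, which gives a
suspension.

The equivalence is explicit. `fromSuspension` sends the meridian over `x` to a path from a fixed
upper vertex through the upper copy of `x` and its lower copy to the apex. `toSuspension` normalizes
the lower part of a point and reads the suspension coordinate off the apex weight minus the upper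
mass. One composite only moves the suspension coordinate. The other involves the fixed upper vertex,
which may be adjacent to the lower part of the point, so no single straight-line homotopy reaches it
from the identity. Two do, with `push` in between (`id_homotopic_push`, `push_homotopic`). -/

open Topology unitInterval

/-! ### Continuity and straight-line homotopies in the weak topology. -/

namespace PreAbstractSimplicialComplex

variable {V W Y : Type*} {K : PreAbstractSimplicialComplex V} {L : PreAbstractSimplicialComplex W}

/-- The total mass of a finitely supported family of reals. -/
noncomputable def mass (V : Type*) : (V →₀ ℝ) →ₗ[ℝ] ℝ :=
  Finsupp.linearCombination ℝ fun _ => (1 : ℝ)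

theorem mass_eq_sum (x : V →₀ ℝ) : mass V x = x.sum fun _ a => a := by
  simp [mass, Finsupp.linearCombination_apply]

@[simp]
theorem mass_single (v : V) (r : ℝ) : mass V (Finsupp.single v r) = r := by
  simp [mass]

@[simp]
theorem mass_mapDomain (f : V → W) (x : V →₀ ℝ) : mass W (x.mapDomain f) = mass V x := by
  simp only [mass, Finsupp.linearCombination_mapDomain]
  rfl

theorem mass_nonneg {x : V →₀ ℝ} (h : ∀ v, 0 ≤ x v) : 0 ≤ mass V x := by
  rw [mass_eq_sum]
  exact Finset.sum_nonneg fun v _ => h v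

theorem support_nonempty_of_mass_ne_zero {x : V →₀ ℝ} (hx : mass V x ≠ 0) : x.support.Nonempty := by
  rw [Finsupp.support_nonempty_iff]
  rintro rfl
  simp at hx

theorem Realization.mass_eq_one (x : K.Realization) : mass V x.1 = 1 := by
  rw [mass_eq_sum]
  exact x.2.2.2

theorem Realization.nonneg (x : K.Realization) (v : V) : 0 ≤ x.1 v := x.2.2.1 v

/-- The point of the realization with given barycentric coordinates. -/
def Realization.ofFace (x : V →₀ ℝ) (hx : ∃ s ∈ K.faces, x.support ⊆ s) (h0 : ∀ v, 0 ≤ x v)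
    (h1 : mass V x = 1) : K.Realization :=
  ⟨x, by
    obtain ⟨s, hs, hxs⟩ := hx
    exact (K.isRelLowerSet_faces hs).2 hxs (support_nonempty_of_mass_ne_zero (by simp [h1])),
    h0, by rw [← mass_eq_sum, h1]⟩

@[simp]
theorem Realization.ofFace_val (x : V →₀ ℝ) (hx : ∃ s ∈ K.faces, x.support ⊆ s)
    (h0 : ∀ v, 0 ≤ x v) (h1 : mass V x = 1) : (ofFace x hx h0 h1).1 = x := rfl

theorem Realization.continuous_iff [TopologicalSpace Y] {f : K.Realization → Y} :
    Continuous f ↔ ∀ s ∈ K.faces, Continuous fun x : K.ClosedSimplex s => f x.1 := by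
  rw [continuous_iSup_dom, Subtype.forall]
  exact forall₂_congr fun s _ => continuous_coinduced_dom

theorem ClosedSimplex.continuous_coe {s : Finset V} (hs : s ∈ K.faces) :
    Continuous fun x : K.ClosedSimplex s => (x.1 : K.Realization) :=
  Realization.continuous_iff.1 continuous_id s hs

theorem ClosedSimplex.continuous_apply (s : Finset V) (v : V) :
    Continuous fun x : K.ClosedSimplex s => x.1.1 v := by
  by_cases hv : v ∈ s
  · have h : Continuous fun x : K.ClosedSimplex s => fun v : s => x.1.1 (v : V) :=
      continuous_induced_dom
    exact (_root_.continuous_apply (A := fun _ : s => ℝ) ⟨v, hv⟩).comp h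
  · have : (fun x : K.ClosedSimplex s => x.1.1 v) = fun _ => 0 := by
      funext x
      exact Finsupp.notMem_support_iff.1 fun h => hv (x.2 h)
    rw [this]
    exact continuous_const

/-- On one closed simplex a functional is a finite combination of coordinates. With the weak
topology this makes total masses continuous even on infinitely many vertices. -/
theorem ClosedSimplex.continuous_linear (s : Finset V) (l : (V →₀ ℝ) →ₗ[ℝ] ℝ) :
    Continuous fun x : K.ClosedSimplex s => l x.1.1 := by
  have : (fun x : K.ClosedSimplex s => l x.1.1) =
      fun x => ∑ v ∈ s, x.1.1 v * l (Finsupp.single v 1) := by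
    funext x
    conv_lhs => rw [← Finsupp.sum_single x.1.1, Finsupp.sum_of_support_subset _ x.2 _ (by simp)]
    rw [map_sum]
    refine Finset.sum_congr rfl fun v _ => ?_
    rw [← smul_eq_mul, ← map_smul, Finsupp.smul_single, smul_eq_mul, mul_one]
  rw [this]
  exact continuous_finsetSum _ fun v _ => (continuous_apply s v).mul continuous_const

theorem Realization.continuous_linear (l : (V →₀ ℝ) →ₗ[ℝ] ℝ) :
    Continuous fun x : K.Realization => l x.1 :=
  continuous_iff.2 fun s _ => ClosedSimplex.continuous_linear s l

/-- A map on `|K| × Z`, with `Z` locally compact, is continuous as soon as it is continuous on the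
products of the closed simplices with `Z`. -/
theorem Realization.continuous_prod {Z : Type*} [TopologicalSpace Z] [LocallyCompactSpace Z]
    [TopologicalSpace Y] {f : K.Realization × Z → Y}
    (h : ∀ s ∈ K.faces, Continuous fun p : K.ClosedSimplex s × Z => f (p.1.1, p.2)) :
    Continuous f := by
  have hx (x : K.Realization) : Continuous fun z => f (x, z) := by
    let y : K.ClosedSimplex x.1.support := ⟨x, subset_rfl⟩
    exact (h x.1.support x.2.1).comp (Continuous.prodMk_right y)
  -- Currying reduces the claim to the universal property of the weak topology; local compactness of
  -- `Z` allows uncurrying.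
  let F : K.Realization → C(Z, Y) := fun x => ⟨fun z => f (x, z), hx x⟩
  have hF : Continuous F :=
    continuous_iff.2 fun s hs => ContinuousMap.continuous_of_continuous_uncurry _ (h s hs)
  exact ContinuousMap.continuous_uncurry_of_continuous ⟨F, hF⟩

/-- A map into a realization which involves finitely many vertices only is continuous as soon as
its barycentric coordinates are. -/
theorem Realization.continuous_of_support_subset [TopologicalSpace Y] {F : Y → L.Realization}
    (T : Finset W) (hT : ∀ y, (F y).1.support ⊆ T) (hc : ∀ w, Continuous fun y => (F y).1 w) :
    Continuous F := by
  classical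
  -- A finite closed cover: on each piece the map lands in a single closed simplex, where continuity
  -- is coordinatewise.
  let C : {s // s ∈ T.powerset ∧ s ∈ L.faces} → Set Y := fun s => {y | (F y).1.support ⊆ s.1}
  have : Finite {s // s ∈ T.powerset ∧ s ∈ L.faces} :=
    Set.Finite.subset T.powerset.finite_toSet fun s hs => hs.1
  refine (locallyFinite_of_finite C).continuous ?_ (fun s => ?_) fun s => ?_
  · exact Set.iUnion_eq_univ_iff.2 fun y =>
      ⟨⟨(F y).1.support, Finset.mem_powerset.2 (hT y), (F y).2.1⟩, Finset.Subset.refl _⟩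
  · have : C s = ⋂ w ∈ {w | w ∉ s.1}, {y | (F y).1 w = 0} := by
      ext y
      simp only [C, Set.mem_ofPred_eq, Set.mem_iInter, Finset.subset_iff, Finsupp.mem_support_iff]
      exact forall_congr' fun w => ⟨fun h hw => not_not.1 fun h' => hw (h h'),
        fun h h' => not_not.1 fun hw => h' (h hw)⟩
    rw [this]
    exact isClosed_biInter fun w _ => isClosed_eq (hc w) continuous_const
  · rw [continuousOn_iff_continuous_domRestrict]
    let G : C s → L.ClosedSimplex s.1 := fun y => ⟨F y.1, y.2⟩
    have hG : Continuous G := continuous_induced_rng.2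
      (continuous_pi fun w => (hc w.1).comp continuous_subtype_val)
    exact (ClosedSimplex.continuous_coe s.2.2).comp hG

/-- Two maps between realizations are homotopic if each point has its two images in a common
closed simplex, and each closed simplex is mapped to finitely many of them. -/
theorem Realization.homotopic_of_support_subset (F₀ F₁ : C(K.Realization, L.Realization))
    (hface : ∀ x, ∃ s, (∃ t ∈ L.faces, s ⊆ t) ∧ (F₀ x).1.support ⊆ s ∧ (F₁ x).1.support ⊆ s)
    (hfin : ∀ s ∈ K.faces, ∃ T : Finset W, ∀ x : K.Realization, x.1.support ⊆ s →
      (F₀ x).1.support ⊆ T ∧ (F₁ x).1.support ⊆ T) : F₀.Homotopic F₁ := by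
  classical
  have hsupp (x : K.Realization) (r : I) {s : Finset W} (h₀ : (F₀ x).1.support ⊆ s)
      (h₁ : (F₁ x).1.support ⊆ s) :
      ((1 - (r : ℝ)) • (F₀ x).1 + (r : ℝ) • (F₁ x).1).support ⊆ s :=
    Finsupp.support_add.trans (Finset.union_subset (Finsupp.support_smul.trans h₀)
      (Finsupp.support_smul.trans h₁))
  let H : K.Realization × I → L.Realization := fun p =>
    ofFace ((1 - (p.2 : ℝ)) • (F₀ p.1).1 + (p.2 : ℝ) • (F₁ p.1).1)
      (by
        obtain ⟨s, ⟨t, ht, hst⟩, h₀, h₁⟩ := hface p.1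
        exact ⟨t, ht, (hsupp p.1 p.2 h₀ h₁).trans hst⟩)
      (fun v => by
        have h1 := mul_nonneg (sub_nonneg.2 p.2.2.2) ((F₀ p.1).nonneg v)
        have h2 := mul_nonneg p.2.2.1 ((F₁ p.1).nonneg v)
        simpa using add_nonneg h1 h2)
      (by simp [mass_eq_one])
  have hH : Continuous H := by
    -- Over a closed simplex only the vertices in `T` occur, so no local finiteness of the complexes
    -- is needed.
    refine continuous_prod fun s hs => ?_
    obtain ⟨T, hT⟩ := hfin s hs
    refine continuous_of_support_subset T
      (fun p => hsupp _ _ (hT p.1.1 p.1.2).1 (hT p.1.1 p.1.2).2) fun w => ?_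
    have h (F : C(K.Realization, L.Realization)) :
        Continuous fun p : K.ClosedSimplex s × I => (F p.1.1).1 w :=
      (continuous_linear (Finsupp.lapply w)).comp (F.continuous.comp
        ((ClosedSimplex.continuous_coe hs).comp continuous_fst))
    have hr : Continuous fun p : K.ClosedSimplex s × I => (p.2 : ℝ) :=
      continuous_subtype_val.comp continuous_snd
    exact ((continuous_const.sub hr).mul (h F₀)).add (hr.mul (h F₁))
  refine ⟨⟨⟨fun p => H (p.2, p.1), hH.comp continuous_swap⟩, fun x => ?_, fun x => ?_⟩⟩
  · exact Subtype.ext (by simp [H])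
  · exact Subtype.ext (by simp [H])

end PreAbstractSimplicialComplex

/-! ### Homotopies on suspensions. -/

namespace Suspension

variable {X Y : Type*}

/-- The point of `ΣX` with coordinates `x` and `s`. -/
def mk (x : X) (s : I) : Suspension X := Quot.mk _ (Sum.inl (x, s))

/-- The two poles of `ΣX`. -/
def pole (X : Type*) (b : Bool) : Suspension X := Quot.mk _ (Sum.inr b)

@[simp]
theorem mk_zero (x : X) : mk x 0 = pole X false := Quot.sound (.bottom x)

@[simp]
theorem mk_one (x : X) : mk x 1 = pole X true := Quot.sound (.top x)

theorem forall_iff {P : Suspension X → Prop} :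
    (∀ q, P q) ↔ (∀ x s, P (mk x s)) ∧ ∀ b, P (pole X b) := by
  refine ⟨fun h => ⟨fun _ _ => h _, fun _ => h _⟩, fun h q => ?_⟩
  induction q using Quot.ind with
  | mk a =>
    rcases a with ⟨x, s⟩ | b
    exacts [h.1 x s, h.2 b]

/-- Maps out of a suspension. -/
def lift (f : X → I → Y) (p : Bool → Y) (h0 : ∀ x, f x 0 = p false)
    (h1 : ∀ x, f x 1 = p true) : Suspension X → Y :=
  Quot.lift (Sum.elim (fun a => f a.1 a.2) p) (by
    rintro _ _ (x | x)
    exacts [h0 x, h1 x])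

variable [TopologicalSpace X] [TopologicalSpace Y]

theorem continuous_mk : Continuous fun p : X × I => mk p.1 p.2 :=
  continuous_quot_mk.comp continuous_inl

theorem continuous_iff {f : Suspension X → Y} :
    Continuous f ↔ Continuous fun p : X × I => f (mk p.1 p.2) :=
  ⟨fun h => h.comp continuous_mk, fun h => continuous_coinduced_dom.2
    (continuous_sum_dom.2 ⟨h, continuous_of_discreteTopology⟩)⟩

/-- The quotient map stays a quotient after a product with a locally compact space, again by
currying. The poles are treated apart because they are not of the form `mk x s` when `X` is empty.
-/
theorem continuous_prod {Z : Type*} [TopologicalSpace Z] [LocallyCompactSpace Z]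
    {f : Suspension X × Z → Y}
    (h : Continuous fun p : (X × I) × Z => f (mk p.1.1 p.1.2, p.2))
    (hp : ∀ b, Continuous fun z => f (pole X b, z)) : Continuous f := by
  have hq : ∀ q, Continuous fun z => f (q, z) :=
    forall_iff.2 ⟨fun x s => h.comp (Continuous.prodMk_right (x, s)), hp⟩
  let F : Suspension X → C(Z, Y) := fun q => ⟨fun z => f (q, z), hq q⟩
  have hF : Continuous F :=
    continuous_iff.2 (ContinuousMap.continuous_of_continuous_uncurry _ h)
  exact ContinuousMap.continuous_uncurry_of_continuous ⟨F, hF⟩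

/-- A self-map of a suspension which only moves the suspension coordinate is homotopic to the
identity. -/
theorem homotopic_id_of_reparam (F : C(Suspension X, Suspension X)) (φ : C(I, I)) (h0 : φ 0 = 0)
    (h1 : φ 1 = 1) (hF : ∀ x s, F (mk x s) = mk x (φ s)) (hp : ∀ b, F (pole X b) = pole X b) :
    F.Homotopic (ContinuousMap.id _) := by
  -- Convex interpolation from `φ` to the identity; it fixes both endpoints, hence descends to the
  -- suspension.
  let θ : I → I → I := fun r s => ⟨(1 - (r : ℝ)) * φ s + r * s, by
    have := (convex_Icc (0 : ℝ) 1) (φ s).2 s.2 (sub_nonneg.2 r.2.2) r.2.1 (by ring)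
    simpa only [smul_eq_mul] using this⟩
  have hθ : Continuous fun p : I × I => θ p.1 p.2 := by
    refine Continuous.subtype_mk ?_ _
    fun_prop
  let H : Suspension X × I → Suspension X := fun p =>
    lift (fun x s => mk x (θ p.2 s)) (pole X)
      (fun x => by
        rw [show θ p.2 0 = 0 from Subtype.ext (by simp [θ, h0]), mk_zero])
      (fun x => by
        rw [show θ p.2 1 = 1 from Subtype.ext (by simp [θ, h1]), mk_one]) p.1
  have hH : Continuous H := continuous_prod
    (continuous_mk.comp (f := fun p : (X × I) × I => (p.1.1, θ p.2 p.1.2)) (by fun_prop))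
    fun b => continuous_const
  refine ⟨⟨⟨fun p => H (p.2, p.1), hH.comp continuous_swap⟩,
    forall_iff.2 ⟨fun x s => ?_, fun b => (hp b).symm⟩,
    forall_iff.2 ⟨fun x s => ?_, fun b => rfl⟩⟩⟩
  · rw [hF]
    exact congrArg (mk x) (Subtype.ext (by simp [θ]))
  · exact congrArg (mk x) (Subtype.ext (by simp [θ]))

/-- Contracting `X` retracts the suspension onto the meridian over `x₀`, which then slides down to
the bottom pole. -/
theorem contractibleSpace [ContractibleSpace X] : ContractibleSpace (Suspension X) := by
  obtain ⟨x₀, ⟨h⟩⟩ := id_nullhomotopic X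
  have hm : Continuous (lift (fun _ s => mk x₀ s) (pole X) (fun _ => mk_zero _)
      fun _ => mk_one _ : Suspension X → Suspension X) :=
    continuous_iff.2 (continuous_mk.comp (f := fun p : X × I => (x₀, p.2)) (by fun_prop))
  let m : C(Suspension X, Suspension X) := ⟨_, hm⟩
  have hid : (ContinuousMap.id (Suspension X)).Homotopic m := by
    let H : Suspension X × I → Suspension X := fun p =>
      lift (fun x s => mk (h (p.2, x)) s) (pole X) (fun _ => mk_zero _) (fun _ => mk_one _) p.1
    have hH : Continuous H := continuous_prod
      (continuous_mk.comp (f := fun p : (X × I) × I => (h (p.2, p.1.1), p.1.2)) (by fun_prop))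
      fun b => continuous_const
    refine ⟨⟨⟨fun p => H (p.2, p.1), hH.comp continuous_swap⟩,
      forall_iff.2 ⟨fun x s => ?_, fun b => rfl⟩, forall_iff.2 ⟨fun x s => ?_, fun b => rfl⟩⟩⟩
    · exact congrArg (mk · s) (h.apply_zero x)
    · exact congrArg (mk · s) (h.apply_one x)
  have hconst : m.Homotopic (ContinuousMap.const _ (pole X false)) := by
    let H : Suspension X × I → Suspension X := fun p =>
      lift (fun _ s => mk x₀ (s * σ p.2)) (fun b => mk x₀ (bif b then σ p.2 else 0))
        (fun _ => by simp) (fun _ => by simp) p.1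
    have hH : Continuous H := continuous_prod
      (continuous_mk.comp (f := fun p : (X × I) × I => (x₀, p.1.2 * σ p.2)) (by fun_prop))
      fun b => continuous_mk.comp (f := fun r : I => (x₀, bif b then σ r else 0)) (by
        cases b <;> simp only [cond_true, cond_false] <;> fun_prop)
    refine ⟨⟨⟨fun p => H (p.2, p.1), hH.comp continuous_swap⟩,
      forall_iff.2 ⟨fun x s => ?_, fun b => ?_⟩, forall_iff.2 ⟨fun x s => ?_, fun b => ?_⟩⟩⟩
    · exact congrArg (mk x₀) (by simp)
    · cases b
      · exact (congrArg (mk x₀) (by simp)).trans (mk_zero x₀)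
      · exact (congrArg (mk x₀) (by simp)).trans (mk_one x₀)
    · exact (congrArg (mk x₀) (by simp)).trans (mk_zero x₀)
    · exact (congrArg (mk x₀) (by cases b <;> simp)).trans (mk_zero x₀)
  exact (contractible_iff_id_nullhomotopic _).2 ⟨_, hid.trans hconst⟩

end Suspension

/-! ### Vertices and adjacency of the Mycielskian. -/

namespace LoopGraph

open PreAbstractSimplicialComplex

variable {V : Type*}

/-- The vertex `(v, 0)` of the Mycielskian. -/
def lower (v : V) : Quotient (topSetoid V 2) := Quotient.mk _ (v, 0)

/-- The vertex `(v, 1)` of the Mycielskian. -/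
def upper (v : V) : Quotient (topSetoid V 2) := Quotient.mk _ (v, 1)

/-- The vertex of the Mycielskian which is the class of all the pairs `(v, 2)`. -/
noncomputable def apex (V : Type*) [Nonempty V] : Quotient (topSetoid V 2) :=
  Quotient.mk _ (Classical.arbitrary V, 2)

theorem mk_eq_mk_iff {p q : V × Fin 3} :
    Quotient.mk (topSetoid V 2) p = Quotient.mk (topSetoid V 2) q ↔
      p = q ∨ (p.2 = 2 ∧ q.2 = 2) := Quotient.eq

theorem lower_injective : Function.Injective (lower (V := V)) := fun v w h => by
  simpa using mk_eq_mk_iff.1 h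

theorem upper_injective : Function.Injective (upper (V := V)) := fun v w h => by
  simpa using mk_eq_mk_iff.1 h

@[simp]
theorem lower_ne_upper (v w : V) : lower v ≠ upper w := fun h => by
  simpa using mk_eq_mk_iff.1 h

@[simp]
theorem upper_ne_lower (v w : V) : upper v ≠ lower w := (lower_ne_upper w v).symm

variable (G : LoopGraph V)

theorem adj_comm {W : Type*} (H : LoopGraph W) {a b : W} : H.Adj a b ↔ H.Adj b a :=
  ⟨fun h => H.symm h, fun h => H.symm h⟩

theorem adj_mk_iff {p q : V × Fin 3} (hp : p.2 ≠ 2) (hq : q.2 ≠ 2) :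
    (G.mycielskian 2).Adj (Quotient.mk _ p) (Quotient.mk _ q) ↔
      G.Adj p.1 q.1 ∧ (loopedPath 2).Adj p.2 q.2 := by
  refine ⟨?_, fun h => ⟨p, q, rfl, rfl, h⟩⟩
  rintro ⟨p', q', h, h', hA⟩
  rcases mk_eq_mk_iff.1 h with rfl | h
  · rcases mk_eq_mk_iff.1 h' with rfl | h'
    · exact hA
    · exact absurd h'.2 hq
  · exact absurd h.2 hp

@[simp]
theorem adj_lower_lower (v w : V) : (G.mycielskian 2).Adj (lower v) (lower w) ↔ G.Adj v w :=
  (adj_mk_iff G (by simp) (by simp)).trans (by simp [loopedPath])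

@[simp]
theorem adj_lower_upper (v w : V) : (G.mycielskian 2).Adj (lower v) (upper w) ↔ G.Adj v w :=
  (adj_mk_iff G (by simp) (by simp)).trans (by simp [loopedPath])

@[simp]
theorem adj_upper_upper (v w : V) : ¬ (G.mycielskian 2).Adj (upper v) (upper w) := fun h => by
  simpa [loopedPath] using ((adj_mk_iff G (by simp) (by simp)).1 h).2

@[simp]
theorem adj_upper_lower (v w : V) : (G.mycielskian 2).Adj (upper v) (lower w) ↔ G.Adj w v := by
  rw [adj_comm, adj_lower_upper]

variable [Nonempty V]

@[simp]
theorem lower_ne_apex (v : V) : lower v ≠ apex V := fun h => by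
  simpa using mk_eq_mk_iff.1 h

@[simp]
theorem upper_ne_apex (v : V) : upper v ≠ apex V := fun h => by
  simpa using mk_eq_mk_iff.1 h

@[simp]
theorem apex_ne_lower (v : V) : apex V ≠ lower v := (lower_ne_apex v).symm

@[simp]
theorem apex_ne_upper (v : V) : apex V ≠ upper v := (upper_ne_apex v).symm

theorem mk_two_eq_apex (v : V) : Quotient.mk (topSetoid V 2) (v, 2) = apex V :=
  mk_eq_mk_iff.2 (Or.inr ⟨rfl, rfl⟩)

theorem forall_vertex {P : Quotient (topSetoid V 2) → Prop} :
    (∀ q, P q) ↔ (∀ v, P (lower v)) ∧ (∀ v, P (upper v)) ∧ P (apex V) := by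
  refine ⟨fun h => ⟨fun _ => h _, fun _ => h _, h _⟩, fun h q => ?_⟩
  induction q using Quotient.ind with
  | _ p =>
    obtain ⟨v, i⟩ := p
    fin_cases i
    · exact h.1 v
    · exact h.2.1 v
    · exact (mk_two_eq_apex v).symm ▸ h.2.2

@[simp]
theorem adj_lower_apex (v : V) : ¬ (G.mycielskian 2).Adj (lower v) (apex V) := by
  rintro ⟨p, q, h, h', hA⟩
  rcases mk_eq_mk_iff.1 h with rfl | h
  · rcases mk_eq_mk_iff.1 h' with rfl | h'
    · simpa [loopedPath] using hA.2
    · simpa [loopedPath, h'.1] using hA.2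
  · simpa using h.2

@[simp]
theorem adj_apex_lower (v : V) : ¬ (G.mycielskian 2).Adj (apex V) (lower v) := by
  rw [adj_comm]
  exact adj_lower_apex G v

@[simp]
theorem adj_apex_apex : ¬ (G.mycielskian 2).Adj (apex V) (apex V) := by
  rintro ⟨p, q, h, h', hA⟩
  have hp : p.2 = 2 := by
    rcases mk_eq_mk_iff.1 h with rfl | h
    exacts [rfl, h.1]
  have hq : q.2 = 2 := by
    rcases mk_eq_mk_iff.1 h' with rfl | h
    exacts [rfl, h.1]
  have := hA.2
  rw [hp, hq] at this
  simp [loopedPath] at this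

/-- The identification at level two makes any neighbour of `v` a witness, whichever representative
defines the apex. -/
theorem adj_upper_apex {v w : V} (h : G.Adj v w) : (G.mycielskian 2).Adj (upper v) (apex V) :=
  ⟨(v, 1), (w, 2), rfl, mk_two_eq_apex w, h, by simp [loopedPath]⟩

/-! ### Independent sets, and the case of an isolated vertex. -/

/-- The set of vertices spans no edge. -/
def IsIndep {W : Type*} (H : LoopGraph W) (s : Finset W) : Prop :=
  ∀ a ∈ s, ∀ b ∈ s, ¬ H.Adj a b

theorem IsIndep.exists_face {W : Type*} {H : LoopGraph W} {s : Finset W} (hs : H.IsIndep s)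
    {x : W →₀ ℝ} (hx : mass W x = 1) (hxs : x.support ⊆ s) :
    ∃ t ∈ H.indepComplex.faces, s ⊆ t :=
  ⟨s, ⟨(support_nonempty_of_mass_ne_zero (by simp [hx])).mono hxs, hs⟩, subset_rfl⟩

/-- If some vertex is isolated, then the independence complex is a cone. -/
theorem contractibleSpace_of_isolated {W : Type*} (H : LoopGraph W) (w : W)
    (hw : ∀ b, ¬ H.Adj w b) : ContractibleSpace H.indepComplex.Realization := by
  classical
  have hw' (b : W) : ¬ H.Adj b w := fun h => hw b (H.symm h)
  have hface : ({w} : Finset W) ∈ H.indepComplex.faces :=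
    ⟨Finset.singleton_nonempty w, fun a ha b _ => by
      rw [Finset.mem_singleton.1 ha]
      exact hw b⟩
  let p : H.indepComplex.Realization := Realization.ofFace (Finsupp.single w 1)
    ⟨_, hface, Finsupp.support_single_subset⟩ (fun v => by
      rw [Finsupp.single_apply]
      positivity) (mass_single w 1)
  refine (contractible_iff_id_nullhomotopic _).2
    ⟨p, Realization.homotopic_of_support_subset _ _ (fun x => ?_) fun s _ => ?_⟩
  -- An isolated vertex can be added to any simplex, so the segment from `x` to `w` stays in the
  -- complex.
  · refine ⟨insert w x.1.support, ⟨_, ⟨Finset.insert_nonempty _ _, ?_⟩, subset_rfl⟩,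
      Finset.subset_insert _ _, ?_⟩
    · intro a ha b hb
      rcases Finset.mem_insert.1 ha with rfl | ha
      · exact hw b
      rcases Finset.mem_insert.1 hb with rfl | hb
      · exact hw' a
      exact x.2.1.2 a ha b hb
    · exact Finsupp.support_single_subset.trans (by simp)
  · exact ⟨insert w s, fun x hx => ⟨hx.trans (Finset.subset_insert _ _),
      Finsupp.support_single_subset.trans (by simp)⟩⟩

theorem nonempty_homotopyEquiv_of_isolated (v : V) (hv : ∀ w, ¬ G.Adj v w) :
    Nonempty (ContinuousMap.HomotopyEquiv (G.mycielskian 2).indepComplex.Realization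
      (Suspension G.indepComplex.Realization)) := by
  have := contractibleSpace_of_isolated G v hv
  have := contractibleSpace_of_isolated (G.mycielskian 2) (lower v)
    (forall_vertex.2 ⟨by simpa using hv, by simpa using hv, by simp⟩)
  have := Suspension.contractibleSpace (X := G.indepComplex.Realization)
  exact ContractibleSpace.hequiv _ _

end LoopGraph

/-! ### Barycentric coordinates on the Mycielskian. -/

namespace LoopGraph

open PreAbstractSimplicialComplex

variable {V : Type*}

/-- The coordinates at the vertices `(v, 0)`. -/
noncomputable def lowerPart (V : Type*) : (Quotient (topSetoid V 2) →₀ ℝ) →ₗ[ℝ] (V →₀ ℝ) :=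
  Finsupp.lcomapDomain lower lower_injective

/-- The coordinates at the vertices `(v, 1)`. -/
noncomputable def upperPart (V : Type*) : (Quotient (topSetoid V 2) →₀ ℝ) →ₗ[ℝ] (V →₀ ℝ) :=
  Finsupp.lcomapDomain upper upper_injective

@[simp]
theorem lowerPart_apply (y : Quotient (topSetoid V 2) →₀ ℝ) (v : V) :
    lowerPart V y v = y (lower v) := rfl

@[simp]
theorem upperPart_apply (y : Quotient (topSetoid V 2) →₀ ℝ) (v : V) :
    upperPart V y v = y (upper v) := rfl

variable {G : LoopGraph V}

-- Upper vertices are pairwise nonadjacent, so independence of `B` is not needed. With `B = A` this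
-- is the prism between the lower and upper copies of a simplex.
open Classical in
theorem IsIndep.image_lower_union_image_upper {A B : Finset V} (hA : G.IsIndep A)
    (hAB : ∀ a ∈ A, ∀ b ∈ B, ¬ G.Adj a b) :
    (G.mycielskian 2).IsIndep (A.image lower ∪ B.image upper) := by
  intro p hp q hq
  simp only [Finset.mem_union, Finset.mem_image] at hp hq
  rcases hp with ⟨v, hv, rfl⟩ | ⟨v, hv, rfl⟩ <;> rcases hq with ⟨w, hw, rfl⟩ | ⟨w, hw, rfl⟩
  · simpa using hA v hv w hw
  · simpa using hAB v hv w hw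
  · simpa using hAB w hw v hv
  · simp

open Classical in
theorem isIndep_image_upper (B : Finset V) : (G.mycielskian 2).IsIndep (B.image upper) := by
  simp [IsIndep]

variable [Nonempty V]

/-- The family with given coordinates at the three kinds of vertices of the Mycielskian. -/
noncomputable def assemble (a b : V →₀ ℝ) (t : ℝ) : Quotient (topSetoid V 2) →₀ ℝ :=
  a.mapDomain lower + b.mapDomain upper + Finsupp.single (apex V) t

section assemble

variable (a b : V →₀ ℝ) (t : ℝ)

@[simp]
theorem assemble_lower (v : V) : assemble a b t (lower v) = a v := by
  simp [assemble, Finsupp.mapDomain_apply lower_injective,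
    Finsupp.mapDomain_of_notMem_range (f := upper) b (lower v) (by simp)]

@[simp]
theorem assemble_upper (v : V) : assemble a b t (upper v) = b v := by
  simp [assemble, Finsupp.mapDomain_apply upper_injective,
    Finsupp.mapDomain_of_notMem_range (f := lower) a (upper v) (by simp)]

@[simp]
theorem assemble_apex : assemble a b t (apex V) = t := by
  simp [assemble, Finsupp.mapDomain_of_notMem_range (f := lower) a (apex V) (by simp),
    Finsupp.mapDomain_of_notMem_range (f := upper) b (apex V) (by simp)]

@[simp]
theorem mass_assemble : mass _ (assemble a b t) = mass V a + mass V b + t := by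
  simp [assemble]

@[simp]
theorem lowerPart_assemble : lowerPart V (assemble a b t) = a := by
  ext v
  simp

@[simp]
theorem upperPart_assemble : upperPart V (assemble a b t) = b := by
  ext v
  simp

theorem assemble_nonneg {a b : V →₀ ℝ} {t : ℝ} (ha : ∀ v, 0 ≤ a v) (hb : ∀ v, 0 ≤ b v)
    (ht : 0 ≤ t) : ∀ q, 0 ≤ assemble a b t q :=
  forall_vertex.2 ⟨by simpa using ha, by simpa using hb, by simpa using ht⟩

end assemble

theorem support_subset_iff {y : Quotient (topSetoid V 2) →₀ ℝ}
    {s : Finset (Quotient (topSetoid V 2))} :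
    y.support ⊆ s ↔ (∀ v, y (lower v) ≠ 0 → lower v ∈ s) ∧
      (∀ v, y (upper v) ≠ 0 → upper v ∈ s) ∧ (y (apex V) ≠ 0 → apex V ∈ s) := by
  simp only [Finset.subset_iff, Finsupp.mem_support_iff]
  exact forall_vertex

theorem assemble_parts (y : Quotient (topSetoid V 2) →₀ ℝ) :
    assemble (lowerPart V y) (upperPart V y) (y (apex V)) = y := by
  refine DFunLike.ext _ _ (forall_vertex.2 ⟨?_, ?_, ?_⟩) <;> simp

theorem mass_parts (y : Quotient (topSetoid V 2) →₀ ℝ) :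
    mass V (lowerPart V y) + mass V (upperPart V y) + y (apex V) = mass _ y := by
  conv_rhs => rw [← assemble_parts y, mass_assemble]

open Classical in
theorem IsIndep.insert_apex_image_lower {A : Finset V} (hA : G.IsIndep A) :
    (G.mycielskian 2).IsIndep (insert (apex V) (A.image lower)) := by
  simp only [IsIndep, Finset.forall_mem_insert, Finset.forall_mem_image]
  exact ⟨by simp, by simpa using fun v hv w hw => hA v hv w hw⟩

/-! ### The map from the suspension. -/

/-- The weight, at height `s` of the suspension, of the vertices `(v, 0)`. -/
noncomputable def lowerWeight (s : ℝ) : ℝ := max 0 (min (4 * s - 1) (2 - 2 * s))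

/-- The weight, at height `s` of the suspension, of the vertices `(v, 1)`. -/
noncomputable def upperWeight (s : ℝ) : ℝ := max 0 (min (4 * s) (2 - 4 * s))

/-- The weight, at height `s` of the suspension, of the base vertex. -/
noncomputable def baseWeight (s : ℝ) : ℝ := max 0 (1 - 4 * s)

/-- The weight, at height `s` of the suspension, of the apex. -/
noncomputable def apexWeight (s : ℝ) : ℝ := max 0 (2 * s - 1)

section weights

variable {s : ℝ}

theorem lowerWeight_nonneg : 0 ≤ lowerWeight s := le_max_left _ _

theorem upperWeight_nonneg : 0 ≤ upperWeight s := le_max_left _ _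

theorem baseWeight_nonneg : 0 ≤ baseWeight s := le_max_left _ _

theorem apexWeight_nonneg : 0 ≤ apexWeight s := le_max_left _ _

theorem lowerWeight_eq_zero (h : s ≤ 1 / 4) : lowerWeight s = 0 :=
  max_eq_left (min_le_of_left_le (by linarith))

theorem upperWeight_eq_zero (h : 1 / 2 ≤ s) : upperWeight s = 0 :=
  max_eq_left (min_le_of_right_le (by linarith))

theorem baseWeight_eq_zero (h : 1 / 4 ≤ s) : baseWeight s = 0 := max_eq_left (by linarith)

theorem apexWeight_eq_zero (h : s ≤ 1 / 2) : apexWeight s = 0 := max_eq_left (by linarith)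

/-- All weights are piecewise linear with breaks at `1/4` and `1/2`. The three stretches run from
the base vertex to the upper copy of `x`, then to the lower copy, then to the apex. -/
theorem sum_weights (h0 : 0 ≤ s) (h1 : s ≤ 1) :
    lowerWeight s + upperWeight s + baseWeight s + apexWeight s = 1 := by
  unfold lowerWeight upperWeight baseWeight apexWeight
  grind

theorem continuous_lowerWeight : Continuous lowerWeight := by
  unfold lowerWeight
  fun_prop

theorem continuous_upperWeight : Continuous upperWeight := by
  unfold upperWeight
  fun_prop

theorem continuous_baseWeight : Continuous baseWeight := by
  unfold baseWeight
  fun_prop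

theorem continuous_apexWeight : Continuous apexWeight := by
  unfold apexWeight
  fun_prop

end weights

/-- The coordinates of the image of the point `(x, s)` of the suspension. -/
noncomputable def suspensionCoords (x : V →₀ ℝ) (s : ℝ) : Quotient (topSetoid V 2) →₀ ℝ :=
  assemble (lowerWeight s • x)
    (upperWeight s • x + baseWeight s • Finsupp.single (Classical.arbitrary V) 1) (apexWeight s)

section suspensionCoords

open Classical

variable {x : V →₀ ℝ} {s : ℝ}

theorem support_suspensionCoords_of_le (h : s ≤ 1 / 4) :
    (suspensionCoords x s).support ⊆ (insert (Classical.arbitrary V) x.support).image upper := by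
  rw [support_subset_iff]
  refine ⟨?_, fun v hv => ?_, ?_⟩
  · simp [suspensionCoords, lowerWeight_eq_zero h]
  · refine Finset.mem_image_of_mem _ ?_
    by_contra hn
    simp only [Finset.mem_insert, Finsupp.mem_support_iff, not_or, not_not] at hn
    simp [suspensionCoords, hn.2, Ne.symm hn.1] at hv
  · simp [suspensionCoords, apexWeight_eq_zero (h.trans (by norm_num))]

theorem support_suspensionCoords_of_le_of_le (h : 1 / 4 ≤ s) (h' : s ≤ 1 / 2) :
    (suspensionCoords x s).support ⊆ x.support.image lower ∪ x.support.image upper := by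
  rw [support_subset_iff]
  refine ⟨fun v hv => ?_, fun v hv => ?_, ?_⟩
  · refine Finset.mem_union_left _ (Finset.mem_image_of_mem _ (Finsupp.mem_support_iff.2 ?_))
    rintro hn
    simp [suspensionCoords, hn] at hv
  · refine Finset.mem_union_right _ (Finset.mem_image_of_mem _ (Finsupp.mem_support_iff.2 ?_))
    rintro hn
    simp [suspensionCoords, hn, baseWeight_eq_zero h] at hv
  · simp [suspensionCoords, apexWeight_eq_zero h']

theorem support_suspensionCoords_of_ge (h : 1 / 2 ≤ s) :
    (suspensionCoords x s).support ⊆ insert (apex V) (x.support.image lower) := by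
  rw [support_subset_iff]
  refine ⟨fun v hv => ?_, ?_, by simp⟩
  · refine Finset.mem_insert_of_mem (Finset.mem_image_of_mem _ (Finsupp.mem_support_iff.2 ?_))
    rintro hn
    simp [suspensionCoords, hn] at hv
  · simp [suspensionCoords, upperWeight_eq_zero h,
      baseWeight_eq_zero (le_trans (by norm_num) h : 1 / 4 ≤ s)]

/-- A finite set of vertices which contains the support of `suspensionCoords x s` if `T` contains
that of `x`. -/
noncomputable def hull (T : Finset V) : Finset (Quotient (topSetoid V 2)) :=
  T.image lower ∪ insert (apex V) ((insert (Classical.arbitrary V) T).image upper)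

theorem support_suspensionCoords_subset_hull {T : Finset V} (h : x.support ⊆ T) :
    (suspensionCoords x s).support ⊆ hull T := by
  have h1 : x.support.image lower ⊆ T.image lower := Finset.image_subset_image h
  have h2 : x.support.image upper ⊆ T.image upper := Finset.image_subset_image h
  rcases le_total s (1 / 4) with h4 | h4
  · refine (support_suspensionCoords_of_le h4).trans ?_
    unfold hull
    grind
  rcases le_total s (1 / 2) with h5 | h5
  · refine (support_suspensionCoords_of_le_of_le h4 h5).trans ?_
    unfold hull
    grind
  · refine (support_suspensionCoords_of_ge h5).trans ?_
    unfold hull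
    grind

/-- Each of the three stretches has its own independent set: upper vertices only, the prism over the
support, the cone from the apex. -/
theorem exists_face_suspensionCoords (hx : G.IsIndep x.support)
    (hm : mass _ (suspensionCoords x s) = 1) :
    ∃ t ∈ (G.mycielskian 2).indepComplex.faces, (suspensionCoords x s).support ⊆ t := by
  suffices h : ∃ t, (G.mycielskian 2).IsIndep t ∧ (suspensionCoords x s).support ⊆ t by
    obtain ⟨t, ht, hs⟩ := h
    obtain ⟨t', ht', hs'⟩ := ht.exists_face hm hs
    exact ⟨t', ht', hs.trans hs'⟩
  rcases le_total s (1 / 4) with h4 | h4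
  · exact ⟨_, isIndep_image_upper _, support_suspensionCoords_of_le h4⟩
  rcases le_total s (1 / 2) with h5 | h5
  · exact ⟨_, hx.image_lower_union_image_upper hx, support_suspensionCoords_of_le_of_le h4 h5⟩
  · exact ⟨_, hx.insert_apex_image_lower, support_suspensionCoords_of_ge h5⟩

theorem suspensionCoords_nonneg (hx : ∀ v, 0 ≤ x v) : ∀ q, 0 ≤ suspensionCoords x s q := by
  refine assemble_nonneg (fun v => ?_) (fun v => ?_) apexWeight_nonneg
  · exact mul_nonneg lowerWeight_nonneg (hx v)
  · refine add_nonneg (mul_nonneg upperWeight_nonneg (hx v)) (mul_nonneg baseWeight_nonneg ?_)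
    rw [Finsupp.single_apply]
    positivity

theorem mass_suspensionCoords (hx : mass V x = 1) (h0 : 0 ≤ s) (h1 : s ≤ 1) :
    mass _ (suspensionCoords x s) = 1 := by
  simp [suspensionCoords, hx, ← add_assoc, sum_weights h0 h1]

theorem suspensionCoords_zero (x : V →₀ ℝ) :
    suspensionCoords x 0 = assemble 0 (Finsupp.single (Classical.arbitrary V) 1) 0 := by
  simp [suspensionCoords, lowerWeight, upperWeight, baseWeight, apexWeight]

theorem suspensionCoords_one (x : V →₀ ℝ) : suspensionCoords x 1 = assemble 0 0 1 := by
  norm_num [suspensionCoords, lowerWeight, upperWeight, baseWeight, apexWeight]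

end suspensionCoords

variable (G)

/-- The coordinate of a pole on the suspension axis. -/
def poleHeight (b : Bool) : ℝ := bif b then 1 else 0

/-- At the poles `x` has weight zero and may be replaced by `0`. This defines the map there even
when `Ind(G)` is empty. -/
theorem mass_suspensionCoords_pole (b : Bool) :
    mass _ (suspensionCoords (0 : V →₀ ℝ) (poleHeight b)) = 1 := by
  cases b
  · simp [poleHeight, suspensionCoords_zero]
  · simp [poleHeight, suspensionCoords_one]

/-- The map from the suspension of `Ind(G)` to the independence complex of the Mycielskian. -/
noncomputable def fromSuspensionFun :
    Suspension G.indepComplex.Realization → (G.mycielskian 2).indepComplex.Realization :=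
  Suspension.lift
    (fun x s => Realization.ofFace (suspensionCoords x.1 s)
      (exists_face_suspensionCoords x.2.1.2 (mass_suspensionCoords x.mass_eq_one s.2.1 s.2.2))
      (suspensionCoords_nonneg x.nonneg) (mass_suspensionCoords x.mass_eq_one s.2.1 s.2.2))
    (fun b => Realization.ofFace (suspensionCoords 0 (poleHeight b))
      (exists_face_suspensionCoords (by simp [IsIndep]) (mass_suspensionCoords_pole b))
      (suspensionCoords_nonneg (by simp)) (mass_suspensionCoords_pole b))
    (fun x => Subtype.ext (by simp [poleHeight, suspensionCoords_zero]))
    (fun x => Subtype.ext (by simp [poleHeight, suspensionCoords_one]))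

theorem continuous_fromSuspensionFun : Continuous G.fromSuspensionFun := by
  refine Suspension.continuous_iff.2 (Realization.continuous_prod fun s hs => ?_)
  refine Realization.continuous_of_support_subset (hull s)
    (fun p => support_suspensionCoords_subset_hull p.1.2) ?_
  have hx (v : V) : Continuous fun p : G.indepComplex.ClosedSimplex s × I => p.1.1.1 v :=
    (ClosedSimplex.continuous_apply s v).comp continuous_fst
  have hs : Continuous fun p : G.indepComplex.ClosedSimplex s × I => (p.2 : ℝ) :=
    continuous_subtype_val.comp continuous_snd
  change ∀ q, Continuous fun p : G.indepComplex.ClosedSimplex s × I =>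
    suspensionCoords p.1.1.1 p.2 q
  refine forall_vertex.2 ⟨fun v => ?_, fun v => ?_, ?_⟩
  · simp only [suspensionCoords, assemble_lower]
    exact (continuous_lowerWeight.comp hs).mul (hx v)
  · simp only [suspensionCoords, assemble_upper]
    exact ((continuous_upperWeight.comp hs).mul (hx v)).add
      ((continuous_baseWeight.comp hs).mul continuous_const)
  · simp only [suspensionCoords, assemble_apex]
    exact continuous_apexWeight.comp hs

/-- The map from the suspension of `Ind(G)` to the independence complex of the Mycielskian. -/
noncomputable def fromSuspension :
    C(Suspension G.indepComplex.Realization, (G.mycielskian 2).indepComplex.Realization) :=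
  ⟨G.fromSuspensionFun, G.continuous_fromSuspensionFun⟩

theorem fromSuspension_mk (x : G.indepComplex.Realization) (s : I) :
    (G.fromSuspension (.mk x s)).1 = suspensionCoords x.1 s := rfl

theorem fromSuspension_pole (b : Bool) :
    (G.fromSuspension (.pole _ b)).1 = suspensionCoords 0 (poleHeight b) := rfl

end LoopGraph

/-! ### The map to the suspension. -/

namespace LoopGraph

open PreAbstractSimplicialComplex

variable {V : Type*} {G : LoopGraph V}

section parts

variable (y : (G.mycielskian 2).indepComplex.Realization)

theorem isIndep_support_lowerPart : G.IsIndep (lowerPart V y.1).support := fun v hv w hw => by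
  have := y.2.1.2 (lower v) (by simpa using hv) (lower w) (by simpa using hw)
  simpa using this

theorem not_adj_of_mem_parts {v w : V} (hv : v ∈ (lowerPart V y.1).support)
    (hw : w ∈ (upperPart V y.1).support) : ¬ G.Adj v w := by
  have := y.2.1.2 (lower v) (by simpa using hv) (upper w) (by simpa using hw)
  simpa using this

theorem lowerPart_nonneg (v : V) : 0 ≤ lowerPart V y.1 v := y.nonneg _

theorem upperPart_nonneg (v : V) : 0 ≤ upperPart V y.1 v := y.nonneg _

theorem mass_upperPart_nonneg : 0 ≤ mass V (upperPart V y.1) := mass_nonneg (upperPart_nonneg y)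

theorem mass_lowerPart_nonneg : 0 ≤ mass V (lowerPart V y.1) := mass_nonneg (lowerPart_nonneg y)

/-- The proportion of the coordinates at the vertices `(v, 0)` which is not pushed to `(v, 1)`. -/
noncomputable def keep : ℝ := max 0 (1 - 4 * mass V (upperPart V y.1))

theorem keep_nonneg : 0 ≤ keep y := le_max_left _ _

theorem keep_le_one : keep y ≤ 1 :=
  max_le zero_le_one (by linarith [mass_upperPart_nonneg y])

end parts

variable [Nonempty V]

section toSuspension

variable (y : (G.mycielskian 2).indepComplex.Realization)

/-- This is where the absence of isolated vertices enters: every upper vertex is adjacent to the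
apex, so the two never share a simplex. -/
theorem upperPart_eq_zero (hG : ∀ v, ∃ w, G.Adj v w) (hy : y.1 (apex V) ≠ 0) :
    upperPart V y.1 = 0 := by
  ext v
  by_contra hv
  obtain ⟨w, hw⟩ := hG v
  exact y.2.1.2 (upper v) (by simpa using hv) (apex V) (by simpa using hy) (G.adj_upper_apex hw)

theorem mass_parts_eq_one :
    mass V (lowerPart V y.1) + mass V (upperPart V y.1) + y.1 (apex V) = 1 :=
  (mass_parts y.1).trans y.mass_eq_one

theorem mass_upperPart_eq_zero_or (hG : ∀ v, ∃ w, G.Adj v w) :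
    mass V (upperPart V y.1) = 0 ∨ y.1 (apex V) = 0 := by
  by_cases hy : y.1 (apex V) = 0
  · exact Or.inr hy
  · exact Or.inl (by rw [upperPart_eq_zero y hG hy, map_zero])

/-- The weight of the apex minus that of the vertices `(v, 1)`. -/
noncomputable def height : ℝ := y.1 (apex V) - mass V (upperPart V y.1)

theorem continuous_height : Continuous (height (G := G)) :=
  Realization.continuous_linear (Finsupp.lapply (apex V) - (mass V).comp (upperPart V))

/-- The normalization of the part of `y` supported by the vertices `(v, 0)`. -/
noncomputable def normalizedLowerPart (h : mass V (lowerPart V y.1) ≠ 0) :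
    G.indepComplex.Realization :=
  Realization.ofFace ((mass V (lowerPart V y.1))⁻¹ • lowerPart V y.1)
    (by
      obtain ⟨t, ht, hs⟩ := (isIndep_support_lowerPart y).exists_face
        (x := (mass V (lowerPart V y.1))⁻¹ • lowerPart V y.1) (by simp [h]) Finsupp.support_smul
      exact ⟨t, ht, Finsupp.support_smul.trans hs⟩)
    (fun v => mul_nonneg (inv_nonneg.2 (mass_lowerPart_nonneg y)) (y.nonneg _)) (by simp [h])

open Classical in
/-- The map from the independence complex of the Mycielskian to the suspension of `Ind(G)`. -/
noncomputable def toSuspensionFun : Suspension G.indepComplex.Realization :=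
  if h : mass V (lowerPart V y.1) = 0 then .pole _ (decide (0 ≤ height y))
  else .mk (normalizedLowerPart y h) (Set.projIcc 0 1 zero_le_one (1 / 2 + height y))

theorem toSuspensionFun_of_ge (h : 1 / 2 ≤ height y) : toSuspensionFun y = .pole _ true := by
  unfold toSuspensionFun
  split_ifs
  · rw [decide_eq_true (by linarith)]
  · rw [Set.projIcc_of_right_le _ (by linarith)]
    exact Suspension.mk_one _

theorem toSuspensionFun_of_le (h : height y ≤ -(1 / 2)) :
    toSuspensionFun y = .pole _ false := by
  unfold toSuspensionFun
  split_ifs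
  · rw [decide_eq_false (by linarith)]
  · rw [Set.projIcc_of_le_left _ (by linarith)]
    exact Suspension.mk_zero _

theorem toSuspensionFun_of_ne_zero (h : mass V (lowerPart V y.1) ≠ 0) :
    toSuspensionFun y =
      .mk (normalizedLowerPart y h) (Set.projIcc 0 1 zero_le_one (1 / 2 + height y)) :=
  dif_neg h

theorem height_of_mass_lowerPart_eq_zero (hG : ∀ v, ∃ w, G.Adj v w)
    (h : mass V (lowerPart V y.1) = 0) : height y = 1 ∨ height y = -1 := by
  have h1 := mass_parts_eq_one y
  unfold height
  rcases mass_upperPart_eq_zero_or y hG with h2 | h2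
  · left; linarith
  · right; linarith

/-- The case `r = 0` is included: the height is then `1` or `-1`, and the clamped coordinate gives
the pole whatever `x` is. -/
theorem toSuspensionFun_eq_mk (hG : ∀ v, ∃ w, G.Adj v w) (x : G.indepComplex.Realization) {r : ℝ}
    (hr : lowerPart V y.1 = r • x.1) :
    toSuspensionFun y = .mk x (Set.projIcc 0 1 zero_le_one (1 / 2 + height y)) := by
  by_cases h : mass V (lowerPart V y.1) = 0
  · rcases height_of_mass_lowerPart_eq_zero y hG h with h1 | h1
    · rw [toSuspensionFun_of_ge y (by linarith), Set.projIcc_of_right_le _ (by linarith)]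
      exact (Suspension.mk_one x).symm
    · rw [toSuspensionFun_of_le y (by linarith), Set.projIcc_of_le_left _ (by linarith)]
      exact (Suspension.mk_zero x).symm
  · rw [toSuspensionFun_of_ne_zero y h]
    congr 1
    refine Subtype.ext ?_
    have hr' : mass V (lowerPart V y.1) = r := by simp [hr, x.mass_eq_one]
    change (mass V (lowerPart V y.1))⁻¹ • lowerPart V y.1 = x.1
    rw [hr'] at h ⊢
    rw [hr, smul_smul, inv_mul_cancel₀ h, one_smul]

end toSuspension

/-- The normalization is undefined where the lower mass vanishes, but the height is `1` or `-1`
there and the map is already constant for heights beyond `1/2` in absolute value. Three closed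
pieces can thus be glued. -/
theorem continuous_toSuspensionFun (hG : ∀ v, ∃ w, G.Adj v w) :
    Continuous (toSuspensionFun (G := G)) := by
  classical
  refine Realization.continuous_iff.2 fun s hs => ?_
  have hh : Continuous fun y : (G.mycielskian 2).indepComplex.ClosedSimplex s => height y.1 :=
    continuous_height.comp (ClosedSimplex.continuous_coe hs)
  let C : Set ((G.mycielskian 2).indepComplex.ClosedSimplex s) := {y | height y.1 ≤ -(1 / 2)}
  let D : Set ((G.mycielskian 2).indepComplex.ClosedSimplex s) :=
    {y | height y.1 ∈ Set.Icc (-(1 / 2)) (1 / 2)}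
  let E : Set ((G.mycielskian 2).indepComplex.ClosedSimplex s) := {y | 1 / 2 ≤ height y.1}
  have hC : ContinuousOn (fun y : (G.mycielskian 2).indepComplex.ClosedSimplex s =>
      toSuspensionFun y.1) C :=
    continuousOn_const.congr fun y hy => toSuspensionFun_of_le y.1 hy
  have hE : ContinuousOn (fun y : (G.mycielskian 2).indepComplex.ClosedSimplex s =>
      toSuspensionFun y.1) E :=
    continuousOn_const.congr fun y hy => toSuspensionFun_of_ge y.1 hy
  have hD : ContinuousOn (fun y : (G.mycielskian 2).indepComplex.ClosedSimplex s =>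
      toSuspensionFun y.1) D := by
    have hne (z : D) : mass V (lowerPart V z.1.1.1) ≠ 0 := fun h => by
      have hz : height z.1.1 ∈ Set.Icc (-(1 / 2) : ℝ) (1 / 2) := z.2
      rcases height_of_mass_lowerPart_eq_zero z.1.1 hG h with h1 | h1 <;> rw [h1] at hz <;>
        norm_num at hz
    rw [continuousOn_iff_continuous_domRestrict]
    have hn : Continuous fun z : D => normalizedLowerPart z.1.1 (hne z) := by
      refine Realization.continuous_of_support_subset (s.preimage lower lower_injective.injOn)
        (fun z => Finsupp.support_smul.trans fun v hv => ?_) fun v => ?_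
      · exact Finset.mem_preimage.2 (z.1.2 (by simpa using hv))
      · have h1 : Continuous fun z : D => mass V (lowerPart V z.1.1.1) :=
          (ClosedSimplex.continuous_linear s ((mass V).comp (lowerPart V))).comp
            continuous_subtype_val
        exact (h1.inv₀ hne).mul
          ((ClosedSimplex.continuous_apply s (lower v)).comp continuous_subtype_val)
    have hp : Continuous fun z : D =>
        Set.projIcc (0 : ℝ) 1 zero_le_one (1 / 2 + height z.1.1) :=
      continuous_projIcc.comp (continuous_const.add (hh.comp continuous_subtype_val))
    exact (Suspension.continuous_mk.comp (hn.prodMk hp)).congr fun z =>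
      (toSuspensionFun_of_ne_zero z.1.1 (hne z)).symm
  have hCc : IsClosed C := isClosed_le hh continuous_const
  have hDc : IsClosed D := isClosed_Icc.preimage hh
  have hEc : IsClosed E := isClosed_le continuous_const hh
  have hu : C ∪ D ∪ E = Set.univ := by
    refine Set.eq_univ_of_forall fun y => ?_
    rcases le_total (height y.1) (-(1 / 2)) with h | h
    · exact Or.inl (Or.inl h)
    rcases le_total (height y.1) (1 / 2) with h' | h'
    · exact Or.inl (Or.inr ⟨h, h'⟩)
    · exact Or.inr h'
  rw [← continuousOn_univ, ← hu]
  exact (hC.union_of_isClosed hD hCc hDc).union_of_isClosed hE (hCc.union hDc) hEc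

/-- The map from the independence complex of the Mycielskian to the suspension of `Ind(G)`. -/
noncomputable def toSuspension (hG : ∀ v, ∃ w, G.Adj v w) :
    C((G.mycielskian 2).indepComplex.Realization, Suspension G.indepComplex.Realization) :=
  ⟨toSuspensionFun, continuous_toSuspensionFun hG⟩

/-- The effect on the suspension coordinate of going to the Mycielskian and back. -/
noncomputable def heightReparam : C(I, I) where
  toFun s := Set.projIcc 0 1 zero_le_one
    (1 / 2 + (apexWeight s - (upperWeight s + baseWeight s)))
  continuous_toFun := by
    have := continuous_apexWeight
    have := continuous_upperWeight
    have := continuous_baseWeight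
    exact continuous_projIcc.comp (by fun_prop)

/-- The lower part of the image of `(x, s)` is a multiple of `x`, so the round trip preserves
meridians. -/
theorem toSuspension_comp_fromSuspension_homotopic (hG : ∀ v, ∃ w, G.Adj v w) :
    ((toSuspension hG).comp G.fromSuspension).Homotopic (ContinuousMap.id _) := by
  refine Suspension.homotopic_id_of_reparam _ heightReparam ?_ ?_ (fun x s => ?_) fun b => ?_
  · refine Set.projIcc_of_le_left zero_le_one ?_
    norm_num [apexWeight, upperWeight, baseWeight]
  · refine Set.projIcc_of_right_le zero_le_one ?_
    norm_num [apexWeight, upperWeight, baseWeight]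
  · refine (toSuspensionFun_eq_mk _ hG x (r := lowerWeight s) ?_).trans ?_
    · rw [fromSuspension_mk, suspensionCoords, lowerPart_assemble]
    · congr 1
      simp only [height, fromSuspension_mk, suspensionCoords, upperPart_assemble, assemble_apex]
      simp [heightReparam, x.mass_eq_one]
  · cases b
    · refine toSuspensionFun_of_le _ ?_
      rw [height, fromSuspension_pole]
      norm_num [poleHeight, suspensionCoords_zero]
    · refine toSuspensionFun_of_ge _ ?_
      rw [height, fromSuspension_pole]
      norm_num [poleHeight, suspensionCoords_one]

/-! ### The homotopy from the identity to the other round trip. -/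

section push

variable (y : (G.mycielskian 2).indepComplex.Realization)

/-- The coordinates of `y`, partially pushed from the vertices `(v, 0)` to the `(v, 1)`. -/
noncomputable def pushCoords : Quotient (topSetoid V 2) →₀ ℝ :=
  assemble (keep y • lowerPart V y.1) (upperPart V y.1 + (1 - keep y) • lowerPart V y.1)
    (y.1 (apex V))

theorem mass_pushCoords : mass _ (pushCoords y) = 1 := by
  have := mass_parts_eq_one y
  simp only [pushCoords, mass_assemble, map_add, map_smul, smul_eq_mul]
  linarith

theorem pushCoords_nonneg : ∀ q, 0 ≤ pushCoords y q :=
  assemble_nonneg (fun _ => mul_nonneg (keep_nonneg y) (y.nonneg _))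
    (fun _ => add_nonneg (y.nonneg _) (mul_nonneg (sub_nonneg.2 (keep_le_one y)) (y.nonneg _)))
    (y.nonneg _)

open Classical in
theorem support_pushCoords_subset : (pushCoords y).support ⊆ y.1.support ∪
    (lowerPart V y.1).support.image upper := by
  rw [support_subset_iff]
  refine ⟨fun v hv => ?_, fun v hv => ?_, fun h => ?_⟩
  · refine Finset.mem_union_left _ (Finsupp.mem_support_iff.2 fun h => hv ?_)
    simp [pushCoords, h]
  · by_cases h : y.1 (upper v) = 0
    · refine Finset.mem_union_right _ (Finset.mem_image_of_mem _ (Finsupp.mem_support_iff.2 ?_))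
      intro h'
      rw [lowerPart_apply] at h'
      simp [pushCoords, h, h'] at hv
    · exact Finset.mem_union_left _ (Finsupp.mem_support_iff.2 h)
  · exact Finset.mem_union_left _ (Finsupp.mem_support_iff.2 (by simpa [pushCoords] using h))

open Classical in
/-- An independent set which contains the vertices of `y` and their pushed images. -/
noncomputable def carrier : Finset (Quotient (topSetoid V 2)) :=
  if y.1 (apex V) = 0 then (lowerPart V y.1).support.image lower ∪
    ((lowerPart V y.1).support ∪ (upperPart V y.1).support).image upper
  else insert (apex V) ((lowerPart V y.1).support.image lower)

theorem isIndep_carrier : (G.mycielskian 2).IsIndep (carrier y) := by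
  classical
  unfold carrier
  split_ifs
  · refine (isIndep_support_lowerPart y).image_lower_union_image_upper fun a ha b hb => ?_
    rcases Finset.mem_union.1 hb with hb | hb
    · exact isIndep_support_lowerPart y a ha b hb
    · exact not_adj_of_mem_parts y ha hb
  · exact (isIndep_support_lowerPart y).insert_apex_image_lower

theorem support_subset_carrier (hG : ∀ v, ∃ w, G.Adj v w) : y.1.support ⊆ carrier y := by
  classical
  rw [support_subset_iff]
  unfold carrier
  split_ifs with h
  · refine ⟨fun v hv => ?_, fun v hv => ?_, fun h' => absurd h h'⟩
    · exact Finset.mem_union_left _ (Finset.mem_image_of_mem _ (by simpa using hv))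
    · exact Finset.mem_union_right _ (Finset.mem_image_of_mem _
        (Finset.mem_union_right _ (by simpa using hv)))
  · refine ⟨fun v hv => ?_, fun v hv => ?_, fun _ => Finset.mem_insert_self _ _⟩
    · exact Finset.mem_insert_of_mem (Finset.mem_image_of_mem _ (by simpa using hv))
    · exact absurd (DFunLike.congr_fun (upperPart_eq_zero y hG h) v) hv

theorem keep_eq_one (hG : ∀ v, ∃ w, G.Adj v w) (h : y.1 (apex V) ≠ 0) : keep y = 1 := by
  simp [keep, upperPart_eq_zero y hG h]

/-- Without upper mass nothing is pushed, so the cone from the apex is fixed; upper vertices would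
not be allowed there. -/
theorem pushCoords_eq_self (hG : ∀ v, ∃ w, G.Adj v w) (h : y.1 (apex V) ≠ 0) :
    pushCoords y = y.1 := by
  conv_rhs => rw [← assemble_parts y.1]
  simp [pushCoords, keep_eq_one y hG h]

theorem support_pushCoords_subset_carrier (hG : ∀ v, ∃ w, G.Adj v w) :
    (pushCoords y).support ⊆ carrier y := by
  classical
  by_cases h : y.1 (apex V) = 0
  · refine (support_pushCoords_subset y).trans
      (Finset.union_subset (support_subset_carrier y hG) ?_)
    rw [carrier, if_pos h]
    exact (Finset.image_subset_image Finset.subset_union_left).trans Finset.subset_union_right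
  · rw [pushCoords_eq_self y hG h]
    exact support_subset_carrier y hG

end push

/-- The self-map of the independence complex of the Mycielskian which pushes the vertices `(v, 0)`
to the vertices `(v, 1)`, away from the apex. -/
noncomputable def push (hG : ∀ v, ∃ w, G.Adj v w) :
    C((G.mycielskian 2).indepComplex.Realization, (G.mycielskian 2).indepComplex.Realization) where
  toFun y := Realization.ofFace (pushCoords y)
    (by
      obtain ⟨t, ht, hs⟩ := (isIndep_carrier y).exists_face (mass_pushCoords y)
        (support_pushCoords_subset_carrier y hG)
      exact ⟨t, ht, (support_pushCoords_subset_carrier y hG).trans hs⟩)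
    (pushCoords_nonneg y) (mass_pushCoords y)
  continuous_toFun := by
    classical
    refine Realization.continuous_iff.2 fun s hs => ?_
    have happ := ClosedSimplex.continuous_apply (K := (G.mycielskian 2).indepComplex) s
    have hk : Continuous fun y : (G.mycielskian 2).indepComplex.ClosedSimplex s => keep y.1 :=
      continuous_const.max (continuous_const.sub (continuous_const.mul
        (ClosedSimplex.continuous_linear s ((mass V).comp (upperPart V)))))
    refine Realization.continuous_of_support_subset
      (s ∪ (s.preimage lower lower_injective.injOn).image upper) (fun y => ?_) ?_
    · refine (support_pushCoords_subset y.1).trans (Finset.union_subset_union y.2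
        (Finset.image_subset_image fun v hv => ?_))
      exact Finset.mem_preimage.2 (y.2 (by simpa using hv))
    · change ∀ q, Continuous fun y : (G.mycielskian 2).indepComplex.ClosedSimplex s =>
        pushCoords y.1 q
      refine forall_vertex.2 ⟨fun v => ?_, fun v => ?_, ?_⟩
      · simp only [pushCoords, assemble_lower]
        exact hk.mul (happ _)
      · simp only [pushCoords, assemble_upper]
        exact (happ _).add ((continuous_const.sub hk).mul (happ _))
      · simp only [pushCoords, assemble_apex]
        exact happ _

theorem support_push_subset (hG : ∀ v, ∃ w, G.Adj v w)
    (s : Finset (Quotient (topSetoid V 2))) : ∃ T : Finset (Quotient (topSetoid V 2)),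
      ∀ y : (G.mycielskian 2).indepComplex.Realization, y.1.support ⊆ s →
        y.1.support ⊆ T ∧ (push hG y).1.support ⊆ T := by
  classical
  refine ⟨s ∪ (s.preimage lower lower_injective.injOn).image upper, fun y hy =>
    ⟨hy.trans Finset.subset_union_left, (support_pushCoords_subset y).trans
      (Finset.union_subset_union hy (Finset.image_subset_image fun v hv => ?_))⟩⟩
  exact Finset.mem_preimage.2 (hy (by simpa using hv))

theorem id_homotopic_push (hG : ∀ v, ∃ w, G.Adj v w) :
    (ContinuousMap.id _).Homotopic (push hG) := by
  refine Realization.homotopic_of_support_subset _ _ (fun y => ?_)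
    fun s _ => support_push_subset hG s
  exact ⟨carrier y, (isIndep_carrier y).exists_face y.mass_eq_one (support_subset_carrier y hG),
    support_subset_carrier y hG, support_pushCoords_subset_carrier y hG⟩

/-- The coordinates of the image of a point under the round trip through the suspension. -/
theorem exists_fromSuspension_toSuspension (hG : ∀ v, ∃ w, G.Adj v w)
    (y : (G.mycielskian 2).indepComplex.Realization) :
    ∃ (x : V →₀ ℝ) (s : ℝ), x.support ⊆ (lowerPart V y.1).support ∧
      (G.fromSuspension (toSuspension hG y)).1 = suspensionCoords x s ∧
      (y.1 (apex V) = 0 → s = max 0 (1 / 2 - mass V (upperPart V y.1))) ∧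
      (y.1 (apex V) ≠ 0 → 1 / 2 ≤ s) := by
  have hy := mass_parts_eq_one y
  by_cases h : mass V (lowerPart V y.1) = 0
  · refine ⟨0, poleHeight (decide (0 ≤ height y)), by simp, ?_, fun h0 => ?_, fun h0 => ?_⟩
    · rw [← fromSuspension_pole]
      exact congrArg (fun z => (G.fromSuspension z).1) (dif_pos h)
    · have h1 : mass V (upperPart V y.1) = 1 := by linarith
      norm_num [height, h0, h1, poleHeight]
    · have h1 : mass V (upperPart V y.1) = 0 := by rw [upperPart_eq_zero y hG h0, map_zero]
      have h2 : 0 ≤ height y := by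
        rw [height, h1]
        linarith
      norm_num [h2, poleHeight]
  · refine ⟨_, _, Finsupp.support_smul, congrArg (fun z => (G.fromSuspension z).1)
      (toSuspensionFun_of_ne_zero y h), fun h0 => ?_, fun h0 => ?_⟩
    · rw [Set.coe_projIcc, height, h0, zero_sub, ← sub_eq_add_neg, min_eq_right]
      linarith [mass_upperPart_nonneg y]
    · have h1 : mass V (upperPart V y.1) = 0 := by rw [upperPart_eq_zero y hG h0, map_zero]
      have h2 := y.nonneg (apex V)
      rw [Set.coe_projIcc, height, h1]
      exact le_max_of_le_right (le_min (by norm_num) (by linarith))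

theorem push_homotopic (hG : ∀ v, ∃ w, G.Adj v w) :
    (push hG).Homotopic (G.fromSuspension.comp (toSuspension hG)) := by
  classical
  refine Realization.homotopic_of_support_subset _ _ (fun y => ?_) fun s _ => ?_
  · obtain ⟨x, s, hx, hgf, h0, h1⟩ := exists_fromSuspension_toSuspension hG y
    suffices h : ∃ t, (G.mycielskian 2).IsIndep t ∧ (pushCoords y).support ⊆ t ∧
        (suspensionCoords x s).support ⊆ t by
      obtain ⟨t, ht, hp, hs⟩ := h
      exact ⟨t, ht.exists_face (mass_pushCoords y) hp, hp, by
        rw [ContinuousMap.comp_apply, hgf]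
        exact hs⟩
    by_cases hy : y.1 (apex V) = 0
    · have hs := h0 hy
      -- At upper mass `1/4` the factor `keep` reaches `0` and the suspension coordinate equals
      -- `1/4`. Above this mass both points lie in the simplex of upper vertices, where the base
      -- vertex is harmless; below it the base vertex has weight zero and `carrier y` contains both.
      rcases le_total (1 / 4) (mass V (upperPart V y.1)) with hm | hm
      · refine ⟨((lowerPart V y.1).support ∪ insert (Classical.arbitrary V)
          (upperPart V y.1).support).image upper, isIndep_image_upper _, ?_, ?_⟩
        · have hk : keep y = 0 := max_eq_left (by linarith)
          rw [support_subset_iff]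
          refine ⟨by simp [pushCoords, hk], fun v hv => Finset.mem_image_of_mem _ ?_,
            by simp [pushCoords, hy]⟩
          by_contra hn
          simp only [Finset.mem_union, Finset.mem_insert, Finsupp.mem_support_iff, not_or,
            not_not, lowerPart_apply, upperPart_apply] at hn
          simp [pushCoords, hn] at hv
        · refine (support_suspensionCoords_of_le ?_).trans (Finset.image_subset_image ?_)
          · rw [hs]
            exact max_le (by norm_num) (by linarith)
          · grind
      · refine ⟨carrier y, isIndep_carrier y, support_pushCoords_subset_carrier y hG,
          (support_suspensionCoords_of_le_of_le ?_ ?_).trans ?_⟩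
        · rw [hs]
          exact le_max_of_le_right (by linarith)
        · rw [hs]
          exact max_le (by norm_num) (by linarith [mass_upperPart_nonneg y])
        · rw [carrier, if_pos hy]
          exact Finset.union_subset_union (Finset.image_subset_image hx)
            (Finset.image_subset_image (hx.trans Finset.subset_union_left))
    · refine ⟨carrier y, isIndep_carrier y, support_pushCoords_subset_carrier y hG,
        (support_suspensionCoords_of_ge (h1 hy)).trans ?_⟩
      rw [carrier, if_neg hy]
      exact Finset.insert_subset_insert _ (Finset.image_subset_image hx)
  · obtain ⟨T, hT⟩ := support_push_subset hG s
    refine ⟨T ∪ hull (s.preimage lower lower_injective.injOn), fun y hy =>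
      ⟨(hT y hy).2.trans Finset.subset_union_left, ?_⟩⟩
    obtain ⟨x, r, hx, hgf, -⟩ := exists_fromSuspension_toSuspension hG y
    rw [ContinuousMap.comp_apply, hgf]
    refine (support_suspensionCoords_subset_hull (hx.trans fun v hv => ?_)).trans
      Finset.subset_union_right
    exact Finset.mem_preimage.2 (hy (by simpa using hv))

end LoopGraph

theorem mainTheorem4 {V : Type*} [Nonempty V] (G : LoopGraph V) :
    Nonempty (ContinuousMap.HomotopyEquiv
      (G.mycielskian 2).indepComplex.Realization
      (Suspension G.indepComplex.Realization)) := by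
  by_cases hG : ∀ v, ∃ w, G.Adj v w
  · exact ⟨⟨LoopGraph.toSuspension hG, G.fromSuspension,
      ((LoopGraph.id_homotopic_push hG).trans (LoopGraph.push_homotopic hG)).symm,
      LoopGraph.toSuspension_comp_fromSuspension_homotopic hG⟩⟩
  · push Not at hG
    obtain ⟨v, hv⟩ := hG
    exact G.nonempty_homotopyEquiv_of_isolated v hv
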